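/- All graphs are finite and simple. A realisation of a graph $G$ is a map $p\colon V(G)\to\mathbb{R}^2$; it is generic if its $2|V(G)|$ coordinates are algebraically independent over $\mathbb{Q}$. A continuous motion of $(G,p)$ is a continuous map $\phi\colon(-1,1)\times V(G)\to\mathbb{R}^2$, written $\phi_t(v)=\phi(t,v)$, such that $\phi_0=p$ and $\|\phi_t(u)-\phi_t(v)\|=\|p(u)-p(v)\|$ for every edge $uv\in E(G)$ and every $t\in(-1,1)$. It is trivial if the last equality holds for all $u,v\in V(G)$ and all $t\in(-1,1)$. The realisation $(G,p)$ is flexible if it has a non-trivial continuous motion, and the graph $G$ is flexible if its generic realisations are flexible. A NAC-colouring of $G$ is a surjective map $c\colon E(G)\to\{\mathrm{red},\mathrm{blue}\}$ such that every cycle of $G$ is either monochromatic or contains at least two red and at least two blue edges. Let $\mathrm{nac}(G)$ denote the number of NAC-colourings of $G$ divided by $2$. For $E'\subseteq E(G)$, let $G[E']$ be the subgraph formed by the edges in $E'$ and their end vertices. A separation of a graph $G$ without isolated vertices is a pair $\{G_1,G_2\}$ of subgraphs such that $G_1=G[E_1]$ and $G_2=G[E_2]$ for some partition $\{E_1,E_2\}$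 of $E(G)$ into two nonempty sets, $V(G_1)\setminus V(G_2)\neq\varnothing$ and $V(G_2)\setminus V(G_1)\neq\varnothing$. **Proposition.** Let $G$ be a connected flexible graph. Then $\mathrm{nac}(G)=1$ if and only if $G$ has a separation $\{G_1,G_2\}$ such that $G_1\cap G_2$ is a single vertex and $\mathrm{nac}(G_1)=\mathrm{nac}(G_2)=0$. -/

import Mathlib

namespace NACFlex

/-- A realisation of a graph with vertex set `V` in the plane: any map to `ℝ²` with its
Euclidean norm. -/
abbrev Realisation (V : Type*) : Type _ := V → EuclideanSpace ℝ (Fin 2)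

section Rigidity

variable {V : Type*}

/-- Two realisations of `G` are equivalent if all edges of `G` have equal lengths in both. -/
def EquivalentRealisations (G : SimpleGraph V) (p q : Realisation V) : Prop :=
  ∀ u v : V, G.Adj u v → ‖p u - p v‖ = ‖q u - q v‖

/-- Two realisations are congruent if all pairs of vertices have equal distances in both. -/
def CongruentRealisations (p q : Realisation V) : Prop :=
  ∀ u v : V, ‖p u - p v‖ = ‖q u - q v‖

/-- `φ` is a continuous motion of `(G, p)`, with time parameter in `(-1, 1)`: only the values
`φ t` for `t ∈ (-1, 1)` matter. -/
def IsContinuousMotion (G : SimpleGraph V) (p : Realisation V) (φ : ℝ → Realisation V) : Prop :=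
  ContinuousOn φ (Set.Ioo (-1) 1) ∧ φ 0 = p ∧
    ∀ t ∈ Set.Ioo (-1 : ℝ) 1, EquivalentRealisations G p (φ t)

/-- The realisation `(G, p)` is flexible: it has a continuous motion that is not trivial, that is,
along which not all realisations are congruent to `p`. -/
def IsFlexibleRealisation (G : SimpleGraph V) (p : Realisation V) : Prop :=
  ∃ φ : ℝ → Realisation V, IsContinuousMotion G p φ ∧
    ¬ ∀ t ∈ Set.Ioo (-1 : ℝ) 1, CongruentRealisations p (φ t)

/-- A realisation is generic if the family of all its coordinates is algebraically independent
over `ℚ`. -/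
def IsGeneric (p : Realisation V) : Prop :=
  AlgebraicIndependent ℚ (fun x : V × Fin 2 => p x.1 x.2)

/-- A graph is (2-)flexible if its generic realisations in the plane are flexible. -/
def IsFlexible (G : SimpleGraph V) : Prop :=
  ∀ p : Realisation V, IsGeneric p → IsFlexibleRealisation G p

end Rigidity

section Colourings

variable {V : Type*}

/-- The number of edges of colour `b` on the walk `w` (each edge counted once). -/
noncomputable def colourCount {G : SimpleGraph V} (c : G.edgeSet → Bool) {u v : V}
    (w : G.Walk u v) (b : Bool) : ℕ :=
  Set.ncard {e : G.edgeSet | (e : Sym2 V) ∈ w.edges ∧ c e = b}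

/-- A NAC-colouring of `G`: an edge colouring with the two colours `true` (red) and `false` (blue)
which is surjective and such that every cycle is either monochromatic or contains at least two red
and two blue edges. -/
def IsNACColouring (G : SimpleGraph V) (c : G.edgeSet → Bool) : Prop :=
  Function.Surjective c ∧
    ∀ (v : V) (w : G.Walk v v), w.IsCycle →
      (∃ b : Bool, ∀ e : G.edgeSet, (e : Sym2 V) ∈ w.edges → c e = b) ∨
      (2 ≤ colourCount c w true ∧ 2 ≤ colourCount c w false)

/-- The number of NAC-colourings of a (finite) graph, divided by two. -/
noncomputable def nnac (G : SimpleGraph V) : ℚ :=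
  (Nat.card {c : G.edgeSet → Bool // IsNACColouring G c} : ℚ) / 2

end Colourings

section Separations

variable {V : Type*}

/-- The edge-induced subgraph `G[E']` : its edges are the edges of `G` in `E'`, its vertices are
the end vertices of these edges. -/
def edgeInduced (G : SimpleGraph V) (E' : Set (Sym2 V)) : G.Subgraph where
  verts := {u | ∃ v, G.Adj u v ∧ s(u, v) ∈ E'}
  Adj u v := G.Adj u v ∧ s(u, v) ∈ E'
  adj_sub h := h.1
  edge_vert {_ v} h := ⟨v, h⟩
  symm := ⟨fun u v h => ⟨h.1.symm, by rw [Sym2.eq_swap]; exact h.2⟩⟩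

/-- `{G₁, G₂}` is a separation of `G` (a graph without isolated vertices). -/
def IsSeparation (G : SimpleGraph V) (G₁ G₂ : G.Subgraph) : Prop :=
  (∃ E₁ E₂ : Set (Sym2 V), E₁.Nonempty ∧ E₂.Nonempty ∧ Disjoint E₁ E₂ ∧ E₁ ∪ E₂ = G.edgeSet ∧
      G₁ = edgeInduced G E₁ ∧ G₂ = edgeInduced G E₂) ∧
    (G₁.verts \ G₂.verts).Nonempty ∧ (G₂.verts \ G₁.verts).Nonempty

end Separations

end NACFlex

/-!
A colouring of the edges with both colours is a NAC-colouring exactly when its colour classes are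
flats of the cycle matroid: an edge whose ends are joined by a monochromatic walk has the colour of
that walk.

Let `c` be the only NAC-colouring of `G` up to swapping the colours, and identify the plane with
`ℂ`. If, along a motion, the ratio of two edge vectors `x u - x v` took infinitely many values, then
its germ along a suitable ultrafilter would be transcendental over `ℂ`, and a valuation of the field
of germs, trivial on `ℂ`, would be larger than `1` on it. On edges
`(x u - x v) * (conj (x u) - conj (x v))` is a nonzero constant, so colouring the edges by whether
the valuation of `x u - x v` exceeds a threshold gives a NAC-colouring separating the two edges. By
uniqueness and continuity the edges of each colour therefore rotate together. If the motion is not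
trivial, then at some time the rotations of the two colours differ, and the edge vectors of the
red edges, with zero vectors on the blue ones, are the edge vectors of a realisation of their own.
If the initial realisation is affinely independent over `ℚ`, this forces two edges at `v` to have
the same colour whenever their other ends are joined by a walk avoiding `v`, so that a vertex at
which both colours meet is a cut vertex.

Conversely, when `G` is the union of two edge-disjoint subgraphs sharing a single vertex, any two
colourings of the parts with flat colour classes combine to one of `G`, as `G` retracts onto each
part. The colouring with one part red and the other blue is then the only NAC-colouring, up to
swapping the colours, exactly when neither part has one.
-/

namespace NACFlex

open Function SimpleGraph

section FlatColourings

variable {V W : Type*} {G : SimpleGraph V} {H : SimpleGraph W} {c : G.edgeSet → Bool} {b : Bool}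
  {u v : V}

/-- The graph formed by the edges of colour `b`, on all vertices of `G`. -/
def colourGraph (c : G.edgeSet → Bool) (b : Bool) : SimpleGraph V where
  Adj u v := ∃ h : G.Adj u v, c ⟨s(u, v), h⟩ = b
  symm := ⟨fun u v ⟨h, hc⟩ => ⟨h.symm, by simpa only [Sym2.eq_swap] using hc⟩⟩
  loopless := ⟨fun _ ⟨h, _⟩ => h.ne rfl⟩

/-- An edge colouring is flat if its colour classes are flats of the cycle matroid: an edge whose
ends are joined by edges of colour `b` has colour `b` itself. -/
def IsFlatColouring (c : G.edgeSet → Bool) : Prop :=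
  ∀ (b : Bool) ⦃u v : V⦄ (h : G.Adj u v), (colourGraph c b).Reachable u v → c ⟨s(u, v), h⟩ = b

theorem colourGraph_le : colourGraph c b ≤ G :=
  fun _ _ h => h.1

theorem colour_eq_of_mem_edges (w : (colourGraph c b).Walk u v) {e : G.edgeSet}
    (he : (e : Sym2 V) ∈ w.edges) : c e = b := by
  obtain ⟨⟨x, y⟩, _⟩ := e
  exact (w.adj_of_mem_edges he).2

theorem two_le_colourCount_iff {w : G.Walk u v} :
    2 ≤ colourCount c w b ↔ ∃ e e' : G.edgeSet,
      ((e : Sym2 V) ∈ w.edges ∧ c e = b) ∧ ((e' : Sym2 V) ∈ w.edges ∧ c e' = b) ∧ e ≠ e' :=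
  Set.one_lt_ncard_iff <| ((List.finite_toSet w.edges).preimage
    Subtype.val_injective.injOn).subset fun _ he => he.1

theorem IsFlatColouring.exists_ne_of_isCycle (hc : IsFlatColouring c) {w : G.Walk v v}
    (hw : w.IsCycle) {e : G.edgeSet} (he : (e : Sym2 V) ∈ w.edges) :
    ∃ e' : G.edgeSet, (e' : Sym2 V) ∈ w.edges ∧ c e' = c e ∧ e ≠ e' := by
  by_contra! h
  obtain ⟨⟨x, y⟩, hxy⟩ := e
  let H := fromEdgeSet {e | e ∈ w.edges}
  have hwH : ∀ e ∈ w.edges, e ∈ H.edgeSet := fun e he => by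
    simpa [H] using ⟨he, G.not_isDiag_of_mem_edgeSet (w.edges_subset_edgeSet he)⟩
  have hreach : (H.deleteEdges {s(x, y)}).Reachable x y :=
    (adj_and_reachable_delete_edges_iff_exists_cycle.2
      ⟨v, w.transfer H hwH, hw.transfer hwH, by rwa [Walk.edges_transfer]⟩).2
  have hle : H.deleteEdges {s(x, y)} ≤ colourGraph c !c ⟨s(x, y), hxy⟩ := by
    intro a a' haa'
    obtain ⟨⟨hmem, -⟩, hne⟩ := (deleteEdges_adj.1 haa').imp_left (fromEdgeSet_adj _).1
    have hadj : G.Adj a a' := w.adj_of_mem_edges hmem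
    exact ⟨hadj, Bool.eq_not.2 fun heq =>
      hne (congrArg Subtype.val (h ⟨s(a, a'), hadj⟩ hmem heq)).symm⟩
  exact Bool.not_ne_self _ (hc _ hxy (hreach.mono hle)).symm

theorem IsNACColouring.isFlatColouring (hc : IsNACColouring G c) : IsFlatColouring c := by
  intro b u v h hr
  by_contra hne
  obtain ⟨p, hp⟩ := hr.symm.exists_isPath
  have hpb : ∀ e : G.edgeSet, (e : Sym2 V) ∈ (p.mapLe colourGraph_le).edges → c e = b :=
    fun e he => colour_eq_of_mem_edges p (by rwa [Walk.edges_mapLe_eq_edges] at he)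
  have hcyc : (Walk.cons h (p.mapLe colourGraph_le)).IsCycle :=
    Path.cons_isCycle ⟨_, hp.mapLe colourGraph_le⟩ h fun he => hne (hpb ⟨s(u, v), h⟩ he)
  have huniq : ∀ e : G.edgeSet, (e : Sym2 V) ∈ (Walk.cons h (p.mapLe colourGraph_le)).edges →
      c e ≠ b → e = ⟨s(u, v), h⟩ := fun e he heb => by
    rw [Walk.edges_cons, List.mem_cons] at he
    exact Subtype.ext (he.resolve_right fun he => heb (hpb e he))
  rcases hc.2 u _ hcyc with ⟨b', hb'⟩ | h2
  · cases p with
    | nil => exact h.ne rfl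
    | cons hvx p =>
      have hb : b' = b := (hb' ⟨_, hvx.1⟩ (by simp)).symm.trans hvx.2
      exact hne ((hb' ⟨s(u, v), h⟩ (by simp)).trans hb)
  · have : 2 ≤ colourCount c (Walk.cons h (p.mapLe colourGraph_le)) !b := by cases b <;> simp [h2]
    obtain ⟨e, e', ⟨he, hce⟩, ⟨he', hce'⟩, hee'⟩ := two_le_colourCount_iff.1 this
    exact hee' ((huniq e he (by simp [hce])).trans (huniq e' he' (by simp [hce'])).symm)

theorem isNACColouring_iff : IsNACColouring G c ↔ Surjective c ∧ IsFlatColouring c := by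
  refine ⟨fun hc => ⟨hc.1, hc.isFlatColouring⟩, fun ⟨hs, hc⟩ => ⟨hs, fun v w hw => ?_⟩⟩
  refine or_iff_not_imp_left.2 fun hmono => ?_
  push Not at hmono
  have two_le : ∀ b, 2 ≤ colourCount c w b := fun b => by
    obtain ⟨e, he, heb⟩ := hmono !b
    obtain ⟨e', he', hee', hne⟩ := hc.exists_ne_of_isCycle hw he
    exact two_le_colourCount_iff.2
      ⟨e, e', ⟨he, Bool.ne_not.1 heb⟩, ⟨he', hee'.trans (Bool.ne_not.1 heb)⟩, hne⟩
  exact ⟨two_le true, two_le false⟩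

theorem isFlatColouring_const (b : Bool) : IsFlatColouring fun _ : G.edgeSet => b :=
  fun _ _ _ h hr => by
    obtain ⟨w⟩ := hr
    cases w with
    | nil => exact (h.ne rfl).elim
    | cons h' _ => exact h'.2

theorem IsFlatColouring.comp_hom (hc : IsFlatColouring c) (f : H →g G) :
    IsFlatColouring (c ∘ f.mapEdgeSet) :=
  fun b _ _ h hr => hc b (f.map_adj h) <| hr.map
    (⟨f, fun h => ⟨f.map_adj h.1, h.2⟩⟩ : colourGraph (c ∘ f.mapEdgeSet) b →g colourGraph c b)

theorem colourGraph_compl : colourGraph cᶜ b = colourGraph c !b := by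
  ext
  simp [colourGraph]

theorem IsNACColouring.compl (hc : IsNACColouring G c) : IsNACColouring G cᶜ := by
  rw [isNACColouring_iff] at hc ⊢
  refine ⟨compl_surjective.comp hc.1, fun b u v h hr => ?_⟩
  rw [colourGraph_compl] at hr
  exact Bool.not_eq_eq_eq_not.2 (hc.2 _ h hr)

theorem nnac_eq_zero_iff [Finite V] : nnac G = 0 ↔ ∀ c, ¬ IsNACColouring G c := by
  simp [nnac, Finite.card_eq_zero_iff, isEmpty_subtype]

theorem exists_isNACColouring_of_nnac_eq_one (hG : nnac G = 1) : ∃ c, IsNACColouring G c := by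
  by_contra! h
  have : IsEmpty {c // IsNACColouring G c} := isEmpty_subtype _ |>.2 h
  simp [nnac] at hG

theorem IsNACColouring.nnac_eq_one_iff (hc : IsNACColouring G c) :
    nnac G = 1 ↔ ∀ d, IsNACColouring G d → d = c ∨ d = cᶜ := by
  have hne : c ≠ cᶜ := fun h => by
    obtain ⟨e, he⟩ := hc.1 true
    simpa [he] using congrFun h e
  rw [nnac, div_eq_one_iff_eq two_ne_zero, ← Nat.cast_ofNat, Nat.cast_inj,
    Nat.card_eq_two_iff' ⟨c, hc⟩]
  constructor
  · rintro ⟨y, -, hy⟩ d hd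
    refine or_iff_not_imp_left.2 fun hdc => congrArg Subtype.val <|
      (hy ⟨d, hd⟩ ?_).trans (hy ⟨cᶜ, hc.compl⟩ ?_).symm
    · simpa using hdc
    · simpa using hne.symm
  · exact fun h => ⟨⟨cᶜ, hc.compl⟩, by simpa using hne.symm, fun d hd =>
      Subtype.ext ((h d d.2).resolve_left fun hdc => hd (Subtype.ext hdc))⟩

end FlatColourings

section OneSums

theorem exists_eq_const_of_not_surjective {α : Type*} {f : α → Bool} (hf : ¬ Surjective f) :
    ∃ b, f = fun _ => b := by
  rw [Surjective, not_forall] at hf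
  obtain ⟨b, hb⟩ := hf
  exact ⟨!b, funext fun a => Bool.eq_not.2 fun h => hb ⟨a, h⟩⟩

variable {V : Type*} {G : SimpleGraph V} {E E₁ E₂ : Set (Sym2 V)} {v x y : V}
  {c : G.edgeSet → Bool} {b : Bool}

/-- The restriction of an edge colouring of `G` to the edge-induced subgraph `G[E]`. -/
def restrictColouring (c : G.edgeSet → Bool) (E : Set (Sym2 V)) :
    (edgeInduced G E).coe.edgeSet → Bool :=
  c ∘ (edgeInduced G E).hom.mapEdgeSet

theorem mem_range_mapEdgeSet_hom {e : G.edgeSet} :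
    e ∈ Set.range (edgeInduced G E).hom.mapEdgeSet ↔ (e : Sym2 V) ∈ E := by
  obtain ⟨⟨x, y⟩, hxy⟩ := e
  constructor
  · rintro ⟨⟨⟨a, a'⟩, ha⟩, he⟩
    rw [← he]
    exact ha.2
  · intro he
    have hadj : (edgeInduced G E).Adj x y := ⟨hxy, he⟩
    exact ⟨⟨s(⟨x, hadj.fst_mem⟩, ⟨y, hadj.snd_mem⟩), hadj⟩, rfl⟩

theorem restrictColouring_eq_const_iff :
    restrictColouring c E = (fun _ => b) ↔ ∀ e : G.edgeSet, (e : Sym2 V) ∈ E → c e = b := by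
  simp only [← mem_range_mapEdgeSet_hom, Set.forall_mem_range]
  exact funext_iff

/-- `G` is the union of the edge-disjoint subgraphs `G[E₁]` and `G[E₂]`, which have exactly the
vertex `v` in common. -/
structure IsOneSum (G : SimpleGraph V) (E₁ E₂ : Set (Sym2 V)) (v : V) : Prop where
  disjoint : Disjoint E₁ E₂
  union_eq : E₁ ∪ E₂ = G.edgeSet
  verts_inter : (edgeInduced G E₁).verts ∩ (edgeInduced G E₂).verts = {v}

namespace IsOneSum

theorem symm (h : IsOneSum G E₁ E₂ v) : IsOneSum G E₂ E₁ v :=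
  ⟨h.disjoint.symm, Set.union_comm E₁ E₂ ▸ h.union_eq, Set.inter_comm _ _ ▸ h.verts_inter⟩

theorem mem_or_mem (h : IsOneSum G E₁ E₂ v) (e : G.edgeSet) :
    (e : Sym2 V) ∈ E₁ ∨ (e : Sym2 V) ∈ E₂ :=
  h.union_eq.ge e.2

theorem mem_left_verts (h : IsOneSum G E₁ E₂ v) : v ∈ (edgeInduced G E₁).verts :=
  (h.verts_inter.ge rfl).1

theorem exists_mem_left (h : IsOneSum G E₁ E₂ v) : ∃ e : G.edgeSet, (e : Sym2 V) ∈ E₁ := by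
  obtain ⟨w, hw, hE⟩ := h.mem_left_verts
  exact ⟨⟨s(v, w), hw⟩, hE⟩

theorem inf_eq (h : IsOneSum G E₁ E₂ v) :
    edgeInduced G E₁ ⊓ edgeInduced G E₂ = G.singletonSubgraph v := by
  refine Subgraph.ext h.verts_inter ?_
  ext x y
  simpa using fun hxy hxy' => Set.disjoint_left.1 h.disjoint hxy.2 hxy'.2

theorem exists_mem_verts_left_diff (h : IsOneSum G E₁ E₂ v) :
    ((edgeInduced G E₁).verts \ (edgeInduced G E₂).verts).Nonempty := by
  obtain ⟨w, hw, hE⟩ := h.mem_left_verts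
  exact ⟨w, ⟨v, hw.symm, Sym2.eq_swap ▸ hE⟩, fun hw₂ =>
    hw.ne' (h.verts_inter.le ⟨⟨v, hw.symm, Sym2.eq_swap ▸ hE⟩, hw₂⟩)⟩

theorem isSeparation (h : IsOneSum G E₁ E₂ v) :
    IsSeparation G (edgeInduced G E₁) (edgeInduced G E₂) :=
  have ⟨e₁, he₁⟩ := h.exists_mem_left
  have ⟨e₂, he₂⟩ := h.symm.exists_mem_left
  ⟨⟨E₁, E₂, ⟨e₁, he₁⟩, ⟨e₂, he₂⟩, h.disjoint, h.union_eq, rfl, rfl⟩,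
    h.exists_mem_verts_left_diff, h.symm.exists_mem_verts_left_diff⟩

theorem colour_eq_of_reachable (h : IsOneSum G E₁ E₂ v)
    (h₁ : IsFlatColouring (restrictColouring c E₁)) (hxy : G.Adj x y) (hE : s(x, y) ∈ E₁)
    (hr : (colourGraph c b).Reachable x y) : c ⟨s(x, y), hxy⟩ = b := by
  classical
  -- `G` retracts onto `G[E₁]` by collapsing everything else to `v`.
  let retract (x : V) : (edgeInduced G E₁).verts :=
    if hx : x ∈ (edgeInduced G E₁).verts then ⟨x, hx⟩ else ⟨v, h.mem_left_verts⟩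
  have retract_of_mem {x : V} (hx : x ∈ (edgeInduced G E₁).verts) : retract x = ⟨x, hx⟩ :=
    dif_pos hx
  have retract_eq {x : V} (hx : x ∈ (edgeInduced G E₂).verts) :
      retract x = ⟨v, h.mem_left_verts⟩ :=
    dite_eq_right_iff.2 fun hx₁ => Subtype.ext (h.verts_inter.le ⟨hx₁, hx⟩)
  have reachable_retract : (colourGraph (restrictColouring c E₁) b).Reachable
      (retract x) (retract y) := by
    rw [reachable_iff_reflTransGen] at hr ⊢
    refine hr.lift' retract fun a a' haa' => (reachable_iff_reflTransGen _ _).1 ?_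
    obtain ⟨hadj, hb⟩ := haa'
    rcases h.mem_or_mem ⟨s(a, a'), hadj⟩ with hE | hE
    · have hE : (edgeInduced G E₁).Adj a a' := ⟨hadj, hE⟩
      rw [retract_of_mem hE.fst_mem, retract_of_mem hE.snd_mem]
      exact Adj.reachable ⟨hE, hb⟩
    · have hE : (edgeInduced G E₂).Adj a a' := ⟨hadj, hE⟩
      rw [retract_eq hE.fst_mem, retract_eq hE.snd_mem]
  have hE : (edgeInduced G E₁).Adj x y := ⟨hxy, hE⟩
  rw [retract_of_mem hE.fst_mem, retract_of_mem hE.snd_mem] at reachable_retract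
  exact h₁ b hE.coe reachable_retract

theorem isFlatColouring (h : IsOneSum G E₁ E₂ v) (h₁ : IsFlatColouring (restrictColouring c E₁))
    (h₂ : IsFlatColouring (restrictColouring c E₂)) : IsFlatColouring c :=
  fun _ x y hxy hr => (h.mem_or_mem ⟨s(x, y), hxy⟩).elim
    (h.colour_eq_of_reachable h₁ hxy · hr) (h.symm.colour_eq_of_reachable h₂ hxy · hr)

end IsOneSum

/-- The colouring of `G` in which exactly the edges in `E` are red. -/
noncomputable def partColouring (G : SimpleGraph V) (E : Set (Sym2 V)) : G.edgeSet → Bool :=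
  fun e => open Classical in decide ((e : Sym2 V) ∈ E)

theorem restrictColouring_partColouring_self :
    restrictColouring (partColouring G E) E = fun _ => true :=
  restrictColouring_eq_const_iff.2 fun _ he => by simpa [partColouring] using he

namespace IsOneSum

theorem restrictColouring_partColouring_right (h : IsOneSum G E₁ E₂ v) :
    restrictColouring (partColouring G E₁) E₂ = fun _ => false :=
  restrictColouring_eq_const_iff.2 fun _ he =>
    by simpa [partColouring] using Set.disjoint_right.1 h.disjoint he

theorem isNACColouring_partColouring (h : IsOneSum G E₁ E₂ v) :
    IsNACColouring G (partColouring G E₁) := by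
  refine isNACColouring_iff.2 ⟨Bool.forall_bool.2 ⟨?_, ?_⟩, h.isFlatColouring ?_ ?_⟩
  · exact h.symm.exists_mem_left.imp
      (restrictColouring_eq_const_iff.1 h.restrictColouring_partColouring_right)
  · exact h.exists_mem_left.imp
      (restrictColouring_eq_const_iff.1 restrictColouring_partColouring_self)
  · exact restrictColouring_partColouring_self (E := E₁) ▸ isFlatColouring_const true
  · exact h.restrictColouring_partColouring_right ▸ isFlatColouring_const false

theorem exists_restrictColouring_eq (h : IsOneSum G E₁ E₂ v)
    {d : (edgeInduced G E₁).coe.edgeSet → Bool} (hd : IsNACColouring _ d) :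
    ∃ c, IsNACColouring G c ∧ restrictColouring c E₁ = d := by
  let c : G.edgeSet → Bool := extend (edgeInduced G E₁).hom.mapEdgeSet d fun _ => false
  have restrict_left : restrictColouring c E₁ = d :=
    extend_comp (Hom.mapEdgeSet.injective _ Subgraph.hom_injective) d _
  have restrict_right : restrictColouring c E₂ = fun _ => false :=
    restrictColouring_eq_const_iff.2 fun e he => extend_apply' _ _ _ fun he₁ =>
      Set.disjoint_left.1 h.disjoint (mem_range_mapEdgeSet_hom.1 he₁) he
  rw [isNACColouring_iff] at hd
  refine ⟨c, isNACColouring_iff.2 ⟨?_, h.isFlatColouring ?_ ?_⟩, restrict_left⟩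
  · exact (restrict_left ▸ hd.1 : Surjective (restrictColouring c E₁)).of_comp
  · exact restrict_left ▸ hd.2
  · exact restrict_right ▸ isFlatColouring_const false

theorem nnac_left_eq_zero [Finite V] (h : IsOneSum G E₁ E₂ v) (hG : nnac G = 1) :
    nnac (edgeInduced G E₁).coe = 0 := by
  refine nnac_eq_zero_iff.2 fun d hd => ?_
  obtain ⟨c, hc, rfl⟩ := h.exists_restrictColouring_eq hd
  obtain ⟨b, hb⟩ : ∃ b, restrictColouring c E₁ = fun _ => b := by
    rcases h.isNACColouring_partColouring.nnac_eq_one_iff.1 hG c hc with rfl | rfl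
    · exact ⟨true, restrictColouring_partColouring_self⟩
    · exact ⟨false, congrArg compl restrictColouring_partColouring_self⟩
  obtain ⟨e, he⟩ := hd.1 !b
  simp [hb] at he

theorem colouring_ext (h : IsOneSum G E₁ E₂ v) {c' : G.edgeSet → Bool}
    (h₁ : restrictColouring c E₁ = restrictColouring c' E₁)
    (h₂ : restrictColouring c E₂ = restrictColouring c' E₂) : c = c' := by
  ext e
  rcases h.mem_or_mem e with he | he <;> obtain ⟨e, rfl⟩ := mem_range_mapEdgeSet_hom.2 he
  · exact congrFun h₁ e
  · exact congrFun h₂ e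

theorem eq_partColouring_or_eq_compl (h : IsOneSum G E₁ E₂ v) (hc : Surjective c)
    (h₁ : ¬ Surjective (restrictColouring c E₁)) (h₂ : ¬ Surjective (restrictColouring c E₂)) :
    c = partColouring G E₁ ∨ c = (partColouring G E₁)ᶜ := by
  obtain ⟨b₁, h₁⟩ := exists_eq_const_of_not_surjective h₁
  obtain ⟨b₂, h₂⟩ := exists_eq_const_of_not_surjective h₂
  have hne : b₁ ≠ b₂ := by
    rintro rfl
    obtain ⟨e, he⟩ := hc !b₁
    exact Bool.not_ne_self b₁ <| he.symm.trans <| (h.mem_or_mem e).elim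
      (restrictColouring_eq_const_iff.1 h₁ e) (restrictColouring_eq_const_iff.1 h₂ e)
  obtain rfl := Bool.eq_not.2 hne.symm
  have hP₁ := restrictColouring_partColouring_self (G := G) (E := E₁)
  have hP₂ := h.restrictColouring_partColouring_right
  cases b₁
  · exact .inr (h.colouring_ext (h₁.trans (congrArg compl hP₁).symm)
      (h₂.trans (congrArg compl hP₂).symm))
  · exact .inl (h.colouring_ext (h₁.trans hP₁.symm) (h₂.trans hP₂.symm))

theorem nnac_eq_one_iff [Finite V] (h : IsOneSum G E₁ E₂ v) :
    nnac G = 1 ↔ nnac (edgeInduced G E₁).coe = 0 ∧ nnac (edgeInduced G E₂).coe = 0 := by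
  refine ⟨fun hG => ⟨h.nnac_left_eq_zero hG, h.symm.nnac_left_eq_zero hG⟩, fun ⟨h₁, h₂⟩ => ?_⟩
  have not_surjective {E : Set (Sym2 V)} (hE : nnac (edgeInduced G E).coe = 0)
      {c : G.edgeSet → Bool} (hc : IsNACColouring G c) : ¬ Surjective (restrictColouring c E) :=
    fun hs => nnac_eq_zero_iff.1 hE _
      (isNACColouring_iff.2 ⟨hs, hc.isFlatColouring.comp_hom _⟩)
  exact h.isNACColouring_partColouring.nnac_eq_one_iff.2 fun c hc =>
    h.eq_partColouring_or_eq_compl hc.1 (not_surjective h₁ hc) (not_surjective h₂ hc)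

end IsOneSum

end OneSums

section CutVertices

variable {V : Type*} {G : SimpleGraph V} {u v w : V}

theorem IsSeparation.exists_isOneSum {G₁ G₂ : G.Subgraph} (hs : IsSeparation G G₁ G₂)
    (hv : G₁ ⊓ G₂ = G.singletonSubgraph v) :
    ∃ E₁ E₂, IsOneSum G E₁ E₂ v ∧ edgeInduced G E₁ = G₁ ∧ edgeInduced G E₂ = G₂ := by
  obtain ⟨⟨E₁, E₂, -, -, hdisj, hunion, rfl, rfl⟩, -⟩ := hs
  exact ⟨E₁, E₂, ⟨hdisj, hunion, congrArg Subgraph.verts hv⟩, rfl, rfl⟩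

theorem exists_isOneSum_of_closed {A : Set V} (hu : G.Adj v u) (hw : G.Adj v w) (huA : u ∈ A)
    (hvA : v ∉ A) (hwA : w ∉ A) (hA : ∀ x ∈ A, ∀ y, G.Adj x y → y ∈ A ∨ y = v) :
    ∃ E₁ E₂, IsOneSum G E₁ E₂ v := by
  let E : Set (Sym2 V) := {e ∈ G.edgeSet | ∃ x ∈ A, x ∈ e}
  refine ⟨E, G.edgeSet \ E, Set.disjoint_sdiff_right,
    Set.union_sdiff_cancel (Set.sep_subset _ _), Set.Subset.antisymm ?_ ?_⟩
  · rintro x ⟨⟨y, hxy, -, z, hzA, hz⟩, y', hxy', hE⟩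
    have hxA : x ∉ A := fun hxA => hE.2 ⟨hE.1, x, hxA, Sym2.mem_mk_left x y'⟩
    rcases Sym2.mem_iff.1 hz with rfl | rfl
    · exact (hxA hzA).elim
    · exact (hA z hzA x hxy.symm).resolve_left hxA
  · rintro _ rfl
    refine ⟨⟨u, hu, hu, u, huA, Sym2.mem_mk_right _ u⟩, w, hw, hw, ?_⟩
    rintro ⟨-, x, hxA, hx⟩
    rcases Sym2.mem_iff.1 hx with rfl | rfl
    exacts [hvA hxA, hwA hxA]

theorem exists_isOneSum_of_not_reachable (hu : G.Adj v u) (hw : G.Adj v w)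
    (hr : ¬ (G.deleteIncidenceSet v).Reachable u w) : ∃ E₁ E₂, IsOneSum G E₁ E₂ v := by
  refine exists_isOneSum_of_closed
    (A := {x | x ≠ v ∧ (G.deleteIncidenceSet v).Reachable u x}) hu hw ⟨hu.ne', .refl u⟩
    (fun h => h.1 rfl) (fun h => hr h.2) fun x hx y hxy => or_iff_not_imp_right.2 fun hyv => ?_
  have hxy' : (G.deleteIncidenceSet v).Adj x y := G.deleteIncidenceSet_adj.2 ⟨hxy, hx.1, hyv⟩
  exact ⟨hyv, hx.2.trans hxy'.reachable⟩

theorem exists_adj_colour_ne (hconn : G.Connected) {c : G.edgeSet → Bool} (hc : Surjective c) :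
    ∃ (u v w : V) (hu : G.Adj v u) (hw : G.Adj v w), c ⟨s(v, u), hu⟩ ≠ c ⟨s(v, w), hw⟩ := by
  obtain ⟨⟨⟨a, a'⟩, ha⟩, hred⟩ := hc true
  obtain ⟨⟨⟨b, b'⟩, hb⟩, hblue⟩ := hc false
  by_contra! h
  let S : Set V := {x | ∃ (y : V) (hxy : G.Adj x y), c ⟨s(x, y), hxy⟩ = true}
  have haS : a ∈ S := ⟨a', ha, hred⟩
  have hbS : b ∉ S := fun ⟨y, hby, hy⟩ =>
    Bool.false_ne_true (hblue.symm.trans ((h b' b y hb hby).trans hy))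
  obtain ⟨d, -, ⟨y, hy, hyred⟩, hsnd⟩ :=
    (hconn.preconnected a b).some.exists_boundary_dart S haS hbS
  refine hsnd ⟨d.fst, d.adj.symm, ?_⟩
  simpa only [Sym2.eq_swap] using (h d.snd d.fst y d.adj hy).trans hyred

end CutVertices

section Valuations

variable {V K Γ₀ : Type*} {G : SimpleGraph V} [Field K] [LinearOrderedCommGroupWithZero Γ₀]

theorem sub_mem_of_reachable {M : Type*} [AddCommGroup M] {u v : V} (h : G.Reachable u v)
    (S : AddSubgroup M) {x : V → M} (hS : ∀ u v, G.Adj u v → x u - x v ∈ S) : x u - x v ∈ S := by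
  obtain ⟨w⟩ := h
  induction w with
  | nil => simp
  | cons h _ ih => simpa using S.add_mem (hS _ _ h) ih

theorem exists_isNACColouring_of_valuation (val : Valuation K Γ₀) (x y : V → K)
    (hxy : ∀ u v, G.Adj u v → val (x u - x v) * val (y u - y v) = 1)
    {a b a' b' : V} (h : G.Adj a b) (h' : G.Adj a' b')
    (hlt : val (x a - x b) < val (x a' - x b')) :
    ∃ c, IsNACColouring G c ∧ c ⟨s(a, b), h⟩ ≠ c ⟨s(a', b'), h'⟩ := by
  let γ : Γ₀ˣ := Units.mk0 _ (left_ne_zero_of_mul_eq_one (hxy a b h))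
  let c (e : G.edgeSet) : Bool := decide
    (Sym2.lift ⟨fun u v => val (x u - x v), fun u v => val.map_sub_swap (x u) (x v)⟩ e.1 ≤ γ)
  have hred {u v : V} (h : G.Adj u v) :
      c ⟨s(u, v), h⟩ = true ↔ x u - x v ∈ val.leAddSubgroup γ :=
    decide_eq_true_iff
  -- On edges the values of the `y`-differences are inverse to those of the `x`-differences.
  have hblue {u v : V} (h : G.Adj u v) :
      c ⟨s(u, v), h⟩ = false ↔ y u - y v ∈ val.ltAddSubgroup γ⁻¹ := by
    rw [← Bool.not_eq_true, hred, Valuation.mem_leAddSubgroup_iff, not_le,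
      Valuation.mem_ltAddSubgroup_iff, eq_inv_of_mul_eq_one_right (hxy u v h),
      Units.val_inv_eq_inv_val,
      inv_lt_inv₀ (zero_lt_iff.2 (left_ne_zero_of_mul_eq_one (hxy u v h))) γ.zero_lt]
  have hab : c ⟨s(a, b), h⟩ = true := (hred h).2 le_rfl
  have hab' : c ⟨s(a', b'), h'⟩ = false := decide_eq_false (not_le.2 hlt)
  refine ⟨c, isNACColouring_iff.2 ⟨Bool.forall_bool.2 ⟨⟨_, hab'⟩, ⟨_, hab⟩⟩, ?_⟩,
    by simp [hab, hab']⟩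
  rintro (_ | _) u v huv hr
  · exact (hblue huv).2 (sub_mem_of_reachable hr _ fun _ _ h => (hblue h.1).1 h.2)
  · exact (hred huv).2 (sub_mem_of_reachable hr _ fun _ _ h => (hred h.1).1 h.2)

theorem exists_one_lt_valuation_of_transcendental {F : Type*} [Field F] [Algebra F K] {x : K}
    (hx : Transcendental F x) :
    ∃ A : ValuationSubring K, A.valuation.IsTrivialOn F ∧ 1 < A.valuation x := by
  have hxF : x ∉ (integralClosure F K).toSubring := fun h => hx (IsIntegral.isAlgebraic h)
  obtain ⟨A, hA, hxA⟩ := Subring.exists_le_valuationSubring_of_isIntegrallyClosedIn hxF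
  have le_one (c : F) : A.valuation (algebraMap F K c) ≤ 1 :=
    (A.valuation_le_one_iff _).2 (hA ((integralClosure F K).algebraMap_mem c))
  refine ⟨A, ⟨fun c hc => (le_one c).antisymm ?_⟩,
    lt_of_not_ge ((A.valuation_le_one_iff x).not.2 hxA)⟩
  have hc' := le_one c⁻¹
  rw [map_inv₀, map_inv₀] at hc'
  exact (inv_le_one₀ (zero_lt_iff.2 (by simpa using hc))).1 hc'

end Valuations

section Germs

open Filter

variable {α R : Type*} {l : Filter α}

theorem exists_ultrafilter_tendsto_cofinite {β : Type*} {f : α → β} (hf : (Set.range f).Infinite) :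
    ∃ U : Ultrafilter α, Tendsto f U cofinite := by
  have : (comap f cofinite).NeBot :=
    comap_neBot_iff_frequently.2 (frequently_cofinite_iff_infinite.2 hf)
  exact ⟨Ultrafilter.of (comap f cofinite), tendsto_comap.mono_left (Ultrafilter.of_le _)⟩

/-- Germs of functions with values in `R` form an `R`-algebra through the constant functions. -/
instance germAlgebra [CommRing R] : Algebra R (Germ l R) :=
  ((Germ.coeRingHom l).comp (Pi.constRingHom α R)).toAlgebra

theorem aeval_germ [CommRing R] (f : α → R) (P : Polynomial R) :
    Polynomial.aeval (f : Germ l R) P = ((fun t => P.eval (f t) : α → R) : Germ l R) := by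
  have h : P.eval₂ (Pi.constRingHom α R) f = fun t => P.eval (f t) :=
    funext fun t => P.hom_eval₂ (Pi.constRingHom α R) (Pi.evalRingHom _ t) f
  rw [← h]
  exact (P.hom_eval₂ (Pi.constRingHom α R) (Germ.coeRingHom l) f).symm

theorem transcendental_germ [CommRing R] [IsDomain R] [l.NeBot] {f : α → R}
    (hf : Tendsto f l cofinite) : Transcendental R (f : Germ l R) := by
  rintro ⟨P, hP0, hP⟩
  rw [aeval_germ] at hP
  have hroot : ∀ᶠ t in l, P.IsRoot (f t) := Germ.coe_eq.1 hP
  have hnonroot : ∀ᶠ t in l, ¬ P.IsRoot (f t) :=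
    hf (Polynomial.finite_setOfPred_isRoot hP0).compl_mem_cofinite
  obtain ⟨t, ht, ht'⟩ := (hroot.and hnonroot).exists
  exact ht' ht

end Germs

section Motions

open Filter

variable {V T : Type*} {G : SimpleGraph V}

theorem exists_isNACColouring_of_infinite_range {ψ : T → V → ℂ} {ℓ : V → V → ℝ}
    (hℓ : ∀ u v, G.Adj u v → ℓ u v ≠ 0)
    (hψ : ∀ t u v, G.Adj u v → ‖ψ t u - ψ t v‖ = ℓ u v)
    {a b a' b' : V} (h : G.Adj a b) (h' : G.Adj a' b')
    (hinf : (Set.range fun t => (ψ t a' - ψ t b') / (ψ t a - ψ t b)).Infinite) :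
    ∃ c, IsNACColouring G c ∧ c ⟨s(a, b), h⟩ ≠ c ⟨s(a', b'), h'⟩ := by
  obtain ⟨U, hU⟩ := exists_ultrafilter_tendsto_cofinite hinf
  obtain ⟨A, hA, hlt⟩ := exists_one_lt_valuation_of_transcendental (transcendental_germ hU)
  let x (v : V) : Germ (U : Filter T) ℂ := ((fun t => ψ t v : T → ℂ) : Germ (U : Filter T) ℂ)
  let y (v : V) : Germ (U : Filter T) ℂ := ((fun t => star (ψ t v) : T → ℂ) : Germ (U : Filter T) ℂ)
  have hxy (u v : V) (huv : G.Adj u v) : A.valuation (x u - x v) * A.valuation (y u - y v) = 1 := by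
    have hmul : (x u - x v) * (y u - y v) = algebraMap ℂ _ ((ℓ u v : ℂ) ^ 2) := by
      refine congrArg Germ.ofFun (funext fun t => ?_)
      rw [← hψ t u v huv]
      exact (congrArg _ (star_sub _ _).symm).trans (Complex.mul_conj' _)
    rw [← map_mul, hmul]
    exact hA.eq_one _ (by simpa using hℓ u v huv)
  refine exists_isNACColouring_of_valuation A.valuation x y hxy h h' ?_
  have hlt : 1 < A.valuation ((x a' - x b') / (x a - x b)) := hlt
  rwa [map_div₀, one_lt_div₀ (zero_lt_iff.2 (left_ne_zero_of_mul_eq_one (hxy a b h)))] at hlt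

theorem div_eq_div_of_nnac_eq_one (hG : nnac G = 1) {c : G.edgeSet → Bool}
    (hc : IsNACColouring G c) [TopologicalSpace T] [PreconnectedSpace T] {ψ : T → V → ℂ}
    (hcont : ∀ v, Continuous fun t => ψ t v) {ℓ : V → V → ℝ} (hℓ : ∀ u v, G.Adj u v → ℓ u v ≠ 0)
    (hψ : ∀ t u v, G.Adj u v → ‖ψ t u - ψ t v‖ = ℓ u v)
    {a b a' b' : V} (h : G.Adj a b) (h' : G.Adj a' b')
    (hcol : c ⟨s(a, b), h⟩ = c ⟨s(a', b'), h'⟩) (s t : T) :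
    (ψ s a' - ψ s b') / (ψ s a - ψ s b) = (ψ t a' - ψ t b') / (ψ t a - ψ t b) := by
  let ρ (t : T) : ℂ := (ψ t a' - ψ t b') / (ψ t a - ψ t b)
  have hne (t : T) : ψ t a - ψ t b ≠ 0 := norm_ne_zero_iff.1 (hψ t a b h ▸ hℓ a b h)
  have hρ : Continuous ρ :=
    ((hcont a').sub (hcont b')).div ((hcont a).sub (hcont b)) hne
  by_contra hst
  have hinf : (Set.range ρ).Infinite := (isPreconnected_range hρ).infinite_of_nontrivial
    ⟨ρ s, ⟨s, rfl⟩, ρ t, ⟨t, rfl⟩, hst⟩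
  obtain ⟨d, hd, hdne⟩ := exists_isNACColouring_of_infinite_range hℓ hψ h h' hinf
  rcases hc.nnac_eq_one_iff.1 hG d hd with rfl | rfl
  · exact hdne hcol
  · exact hdne (congrArg (!·) hcol)

/-- `ψ₁` arises from `ψ₀` by rotating the edge vectors of each colour `b` by `R b`. -/
def IsColourwiseRotation (c : G.edgeSet → Bool) (ψ₀ ψ₁ : V → ℂ) (R : Bool → Circle) : Prop :=
  ∀ u v (h : G.Adj u v), ψ₁ u - ψ₁ v = R (c ⟨s(u, v), h⟩) * (ψ₀ u - ψ₀ v)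

theorem exists_isColourwiseRotation (hG : nnac G = 1) {c : G.edgeSet → Bool}
    (hc : IsNACColouring G c) [TopologicalSpace T] [PreconnectedSpace T] {ψ : T → V → ℂ}
    (hcont : ∀ v, Continuous fun t => ψ t v) {ℓ : V → V → ℝ} (hℓ : ∀ u v, G.Adj u v → ℓ u v ≠ 0)
    (hψ : ∀ t u v, G.Adj u v → ‖ψ t u - ψ t v‖ = ℓ u v) (s t : T) :
    ∃ R, IsColourwiseRotation c (ψ s) (ψ t) R := by
  have hne {u v : V} (h : G.Adj u v) (t : T) : ψ t u - ψ t v ≠ 0 :=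
    norm_ne_zero_iff.1 (hψ t u v h ▸ hℓ u v h)
  have hrot (b : Bool) : ∃ R : Circle, ∀ u v (h : G.Adj u v), c ⟨s(u, v), h⟩ = b →
      ψ t u - ψ t v = R * (ψ s u - ψ s v) := by
    obtain ⟨⟨⟨x, y⟩, hxy : G.Adj x y⟩, hb⟩ := hc.1 b
    refine ⟨⟨(ψ t x - ψ t y) / (ψ s x - ψ s y), mem_sphere_zero_iff_norm.2 ?_⟩, fun u v h huv => ?_⟩
    · rw [norm_div, hψ t x y hxy, hψ s x y hxy, div_self (hℓ x y hxy)]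
    · have hratio := div_eq_div_of_nnac_eq_one hG hc hcont hℓ hψ hxy h (hb.trans huv.symm) t s
      rw [div_eq_div_iff (hne hxy t) (hne hxy s)] at hratio
      change _ = (ψ t x - ψ t y) / (ψ s x - ψ s y) * _
      rw [div_mul_eq_mul_div, eq_div_iff (hne hxy s), hratio, mul_comm]
  choose R hR using hrot
  exact ⟨R, fun u v h => hR _ u v h rfl⟩

theorem IsColourwiseRotation.norm_sub_eq (hconn : G.Connected) {c : G.edgeSet → Bool}
    {ψ₀ ψ₁ : V → ℂ} {R : Bool → Circle} (h : IsColourwiseRotation c ψ₀ ψ₁ R)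
    (hR : R true = R false) (u v : V) : ‖ψ₁ u - ψ₁ v‖ = ‖ψ₀ u - ψ₀ v‖ := by
  have hconst (b : Bool) : R b = R false := by cases b <;> simp [hR]
  have hz := sub_mem_of_reachable (hconn.preconnected u v) ⊥
    (x := fun u => ψ₁ u - R false * ψ₀ u) fun u v huv => by
      have huv := h u v huv
      rw [hconst] at huv
      rw [AddSubgroup.mem_bot]
      linear_combination huv
  have hrot : ψ₁ u - ψ₁ v = R false * (ψ₀ u - ψ₀ v) := by
    linear_combination AddSubgroup.mem_bot.1 hz
  rw [hrot, norm_mul, Circle.norm_coe, one_mul]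

end Motions

section RedParts

variable {V E : Type*} {G : SimpleGraph V} [AddCommGroup E]

/-- The edge vectors of `r` are those of `p` on red edges and `0` on blue edges: `r` records the
part of the shape of `p` that the red edges account for. -/
def IsRedPart (c : G.edgeSet → Bool) (p r : V → E) : Prop :=
  ∀ u v (h : G.Adj u v), r u - r v = if c ⟨s(u, v), h⟩ then p u - p v else 0

theorem IsRedPart.comp_hom {F : Type*} [AddCommGroup F] {c : G.edgeSet → Bool} {p r : V → E}
    (hr : IsRedPart c p r) (f : E →+ F) : IsRedPart c (f ∘ p) (f ∘ r) := fun u v h => by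
  simp only [comp_apply, ← map_sub, hr u v h, apply_ite f, map_zero]

theorem IsColourwiseRotation.exists_isRedPart {c : G.edgeSet → Bool} {ψ₀ ψ₁ : V → ℂ}
    {R : Bool → Circle} (h : IsColourwiseRotation c ψ₀ ψ₁ R) (hR : R true ≠ R false) :
    ∃ r, IsRedPart c ψ₀ r := by
  have hR' : (R true - R false : ℂ) ≠ 0 := sub_ne_zero.2 (Circle.coe_injective.ne hR)
  refine ⟨fun u => (ψ₁ u - R false * ψ₀ u) / (R true - R false), fun u v huv => ?_⟩
  have huv' := h u v huv
  rw [← sub_div]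
  rcases hb : c ⟨s(u, v), huv⟩ with _ | _ <;> rw [hb] at huv'
  · rw [if_neg Bool.false_ne_true, div_eq_zero_iff]
    left
    linear_combination huv'
  · rw [if_pos rfl, div_eq_iff hR']
    linear_combination huv'

variable {k : Type*} [Field k] [Module k E]

theorem exists_linearMap_sub_eq_one {p : V → E} (hp : AffineIndependent k p) (v : V) :
    ∃ f : E →ₗ[k] k, ∀ x ≠ v, f (p v - p x) = 1 := by
  have hli := (affineIndependent_iff_linearIndependent_vsub k p v).1 hp
  obtain ⟨f, hf⟩ := ((Module.Basis.span hli).constr k fun _ => (-1 : k)).exists_extend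
  refine ⟨f, fun x hx => ?_⟩
  have hx' : f (p x - p v) = -1 := by
    have h := LinearMap.congr_fun hf (Module.Basis.span hli ⟨x, hx⟩)
    rwa [Module.Basis.constr_basis, LinearMap.comp_apply, Submodule.subtype_apply,
      Module.Basis.span_apply hli] at h
  rw [← neg_sub, map_neg, hx', neg_neg]

theorem IsRedPart.colour_eq {c : G.edgeSet → Bool} {p r : V → E} (hr : IsRedPart c p r)
    (hp : AffineIndependent k p) {v u w : V} (hu : G.Adj v u) (hw : G.Adj v w)
    (huw : (G.deleteIncidenceSet v).Reachable u w) : c ⟨s(v, u), hu⟩ = c ⟨s(v, w), hw⟩ := by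
  -- `f` vanishes on the edge vectors of `p` away from `v`, and so on all those of `r`; on the edge
  -- vectors of `r` at `v` it takes the value `1` or `0` according to the colour.
  obtain ⟨f, hf⟩ := exists_linearMap_sub_eq_one hp v
  have hfr := hr.comp_hom f.toAddMonoidHom
  have hcol {x : V} (hx : G.Adj v x) :
      f (r v) - f (r x) = if c ⟨s(v, x), hx⟩ then 1 else 0 := by
    rw [← hf x hx.ne', map_sub]; exact hfr v x hx
  have heq : f (r u) = f (r w) := by
    refine sub_eq_zero.1 (sub_mem_of_reachable huw ⊥ (x := f ∘ r) fun x y hxy => ?_)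
    obtain ⟨hxy, hxv, hyv⟩ := G.deleteIncidenceSet_adj.1 hxy
    have hfp : f (p x) - f (p y) = 0 := by
      rw [← map_sub, ← sub_sub_sub_cancel_left (p y) (p x) (p v), map_sub, hf x hxv, hf y hyv,
        sub_self]
    exact (hfr x y hxy).trans (ite_eq_right_iff.2 fun _ => hfp)
  have hite := (hcol hu).symm.trans (heq ▸ hcol hw)
  cases h₁ : c ⟨s(v, u), hu⟩ <;> cases h₂ : c ⟨s(v, w), hw⟩ <;> simp [h₁, h₂] at hite ⊢

end RedParts

section FlexibleRealisations

variable {V : Type*} {G : SimpleGraph V} {p : Realisation V}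

theorem exists_isRedPart (hconn : G.Connected) (hinj : Injective p)
    (hflex : IsFlexibleRealisation G p) (hG : nnac G = 1) {c : G.edgeSet → Bool}
    (hc : IsNACColouring G c) : ∃ r, IsRedPart c p r := by
  obtain ⟨φ, ⟨hcont, rfl, hφ⟩, hnt⟩ := hflex
  push Not at hnt
  obtain ⟨t, ht, hnc⟩ := hnt
  let L : EuclideanSpace ℝ (Fin 2) ≃ₗᵢ[ℝ] ℂ := Complex.orthonormalBasisOneI.repr.symm
  let ψ (t : Set.Ioo (-1 : ℝ) 1) (v : V) : ℂ := L (φ t v)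
  have hnorm (t : Set.Ioo (-1 : ℝ) 1) (u v : V) : ‖ψ t u - ψ t v‖ = ‖φ t u - φ t v‖ := by
    rw [← map_sub, L.norm_map]
  have : PreconnectedSpace (Set.Ioo (-1 : ℝ) 1) := Subtype.preconnectedSpace isPreconnected_Ioo
  obtain ⟨R, hR⟩ := exists_isColourwiseRotation (ψ := ψ) hG hc
    (fun v => L.continuous.comp ((continuous_apply v).comp hcont.domRestrict))
    (fun u v h => norm_ne_zero_iff.2 (sub_ne_zero.2 (hinj.ne h.ne)))
    (fun t u v h => (hnorm t u v).trans (hφ t t.2 u v h).symm) ⟨0, by simp⟩ ⟨t, ht⟩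
  have hRne : R true ≠ R false := fun h => hnc fun u v => by
    rw [← hnorm ⟨t, ht⟩, hR.norm_sub_eq hconn h, hnorm]
  obtain ⟨r, hr⟩ := hR.exists_isRedPart hRne
  refine ⟨L.symm ∘ r, ?_⟩
  have hφ₀ : φ 0 = L.symm ∘ ψ ⟨0, by simp⟩ := funext fun v => (L.symm_apply_apply _).symm
  exact hφ₀ ▸ hr.comp_hom (L.symm.toLinearEquiv : ℂ →+ EuclideanSpace ℝ (Fin 2))

theorem exists_isOneSum_of_nnac_eq_one (hconn : G.Connected) (hp : AffineIndependent ℚ p)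
    (hflex : IsFlexibleRealisation G p) (hG : nnac G = 1) : ∃ E₁ E₂ v, IsOneSum G E₁ E₂ v := by
  obtain ⟨c, hc⟩ := exists_isNACColouring_of_nnac_eq_one hG
  obtain ⟨r, hr⟩ := exists_isRedPart hconn hp.injective hflex hG hc
  obtain ⟨u, v, w, hu, hw, hne⟩ := exists_adj_colour_ne hconn hc.1
  obtain ⟨E₁, E₂, h⟩ :=
    exists_isOneSum_of_not_reachable hu hw fun h => hne (hr.colour_eq hp hu hw h)
  exact ⟨E₁, E₂, v, h⟩

end FlexibleRealisations

section Generic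

theorem exists_algebraicIndependent_real (ι : Type*) [Countable ι] :
    ∃ x : ι → ℝ, AlgebraicIndependent ℚ x := by
  obtain ⟨κ, x, hx⟩ := exists_isTranscendenceBasis' ℚ ℝ
  have : Infinite κ := by
    by_contra hκ
    rw [not_infinite_iff_finite] at hκ
    have hcount : Cardinal.mk (Algebra.adjoin ℚ (Set.range x)) ≤ Cardinal.aleph0 := by
      rw [← Cardinal.mk_congr hx.1.aevalEquiv.toEquiv]
      exact MvPolynomial.cardinalMk_le_max.trans (by simp)
    have := hx.isAlgebraic
    have hle := Algebra.IsAlgebraic.cardinalMk_le_max (Algebra.adjoin ℚ (Set.range x)) ℝ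
    rw [max_eq_right hcount, Cardinal.mk_real] at hle
    exact Cardinal.aleph0_lt_continuum.not_ge hle
  obtain ⟨f, hf⟩ := exists_injective_nat ι
  exact ⟨x ∘ Infinite.natEmbedding κ ∘ f,
    hx.1.comp _ ((Infinite.natEmbedding κ).injective.comp hf)⟩

theorem exists_isGeneric (V : Type*) [Countable V] : ∃ p : Realisation V, IsGeneric p := by
  obtain ⟨x, hx⟩ := exists_algebraicIndependent_real (V × Fin 2)
  exact ⟨fun v => WithLp.toLp 2 fun i => x (v, i), hx⟩

theorem IsGeneric.affineIndependent {V : Type*} {p : Realisation V} (hp : IsGeneric p) :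
    AffineIndependent ℚ p := by
  have hcoord : LinearIndependent ℚ fun v => p v 0 :=
    hp.linearIndependent.comp (fun v => (v, 0)) (Prod.mk_left_injective 0)
  let f : EuclideanSpace ℝ (Fin 2) →ₗ[ℚ] ℝ :=
    (EuclideanSpace.proj (𝕜 := ℝ) (0 : Fin 2)).toLinearMap.restrictScalars ℚ
  exact (hcoord.of_comp f).affineIndependent

end Generic

end NACFlex

theorem proposition5p10_general {V : Type*} [Finite V] (G : SimpleGraph V) (hconn : G.Connected)
    {p : NACFlex.Realisation V} (hp : AffineIndependent ℚ p)
    (hflex : NACFlex.IsFlexibleRealisation G p) :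
    NACFlex.nnac G = 1 ↔
      ∃ G₁ G₂ : G.Subgraph, NACFlex.IsSeparation G G₁ G₂ ∧
        (∃ v : V, G₁ ⊓ G₂ = G.singletonSubgraph v) ∧
        NACFlex.nnac G₁.coe = 0 ∧ NACFlex.nnac G₂.coe = 0 := by
  constructor
  · intro hG
    obtain ⟨E₁, E₂, v, h⟩ := NACFlex.exists_isOneSum_of_nnac_eq_one hconn hp hflex hG
    exact ⟨_, _, h.isSeparation, ⟨v, h.inf_eq⟩, h.nnac_eq_one_iff.1 hG⟩
  · rintro ⟨G₁, G₂, hs, ⟨v, hv⟩, hG₁, hG₂⟩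
    obtain ⟨E₁, E₂, h, rfl, rfl⟩ := hs.exists_isOneSum hv
    exact h.nnac_eq_one_iff.2 ⟨hG₁, hG₂⟩

theorem proposition5p10 {V : Type*} [Finite V] (G : SimpleGraph V) (hconn : G.Connected)
    (hflex : NACFlex.IsFlexible G) :
    NACFlex.nnac G = 1 ↔
      ∃ G₁ G₂ : G.Subgraph, NACFlex.IsSeparation G G₁ G₂ ∧
        (∃ v : V, G₁ ⊓ G₂ = G.singletonSubgraph v) ∧
        NACFlex.nnac G₁.coe = 0 ∧ NACFlex.nnac G₂.coe = 0 := by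
  obtain ⟨p, hp⟩ := NACFlex.exists_isGeneric V
  exact proposition5p10_general G hconn hp.affineIndependent (hflex p hp)
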